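/- Fix a first-order signature $L$. All $L$-structures are non-empty and all filters are proper. For a family $(M_i)_{i\in I}$ of $L$-structures and a filter $F$ on $I$, the reduced product $\prod_i M_i/F$ is the $L$-structure on $\prod_i M_i$ modulo the relation ``$a_i=b_i$ for $F$-many $i$'' (that is, $\{i : a_i=b_i\}\in F$), where functions are computed coordinatewise and a relation $R$ holds of a tuple of classes iff it holds of the $i$-th coordinates in $M_i$ for $F$-many $i$; the reduced power $M^F$ is the case where all $M_i=M$. A theory $T$ is - preserved under reduced products if, for all $(M_i)_{i\in I}$ and $F$, $M_i\models T$ for $F$-many $i$ implies $\prod_i M_i/F\models T$; - copreserved under reduced products if, for all $(M_i)_{i\in I}$ and $F$, $\prod_i M_i/F\models T$ implies $M_i\models T$ for $F$-many $i$; - preserved under reduced roots if, for all $M$ and $F$, $M^F\models T$ implies $M\models T$; - preserved under (finite) cartesian factors if, for every (finite) family $(M_i)_{i\in I}$, $\prod_i M_i\models T$ implies $M_i\models T$ for every $i$. A formula $\phi(x)$ is bipreserved under reduced products if the theory $\{\phi(x)\}$, in the language $L(x)$ obtained from $L$ by adding the variables $x$ as new constants, is both preserved and copreserved under reduced products. The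 set of Palyutin formulas is the smallest set of first-order formulas that contains the atomic formulas (equalities of terms and relation symbols applied to terms; falsity is not atomic), is closed under conjunction, existential and universal quantification, and contains $(\exists x\,\phi)\wedge\forall x\,(\phi\rightarrow\psi)$ whenever it contains $\phi$ and $\psi$. A Palyutin sentence is a Palyutin formula without free variables. **Theorem.** (1) Let $T$ be a consistent $L$-theory. Then $T$ is preserved under reduced products, reduced roots and cartesian factors if and only if $T$ is axiomatisable by Palyutin sentences, i.e. has the same models as some set of Palyutin sentences. The same equivalence holds with finite cartesian factors in place of arbitrary cartesian factors. (2) Let $\phi(x)$ be a satisfiable formula. Then $\phi$ is bipreserved under reduced products if and only if $\phi$ is logically equivalent to a Palyutin formula in the variables $x$. -/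

import Mathlib

universe u v w x

open FirstOrder FirstOrder.Language

namespace Palyutin

section Products

/-- The structure on representatives, together with the relation "equal for `F`-many indices". -/
@[reducible]
def productPrestructure {L : FirstOrder.Language.{u, v}} {I : Type*} (F : Filter I) (M : I → Type*)
    [∀ i, L.Structure (M i)] : L.Prestructure (F.productSetoid M) where
  toStructure :=
    { funMap := fun {_} f x i => Structure.funMap f fun k => x k i
      RelMap := fun {_} R x => ∀ᶠ i in F, Structure.RelMap R fun k => x k i }
  fun_equiv := fun {n} f x y hxy => by
    have h : ∀ᶠ i in F, ∀ k : Fin n, x k i = y k i := Filter.eventually_all.2 hxy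
    exact h.mono fun i hi => congrArg (Structure.funMap f) (funext hi)
  rel_equiv := fun {n} R x y hxy => by
    have h : ∀ᶠ i in F, ∀ k : Fin n, x k i = y k i := Filter.eventually_all.2 hxy
    refine propext (Filter.eventually_congr (h.mono fun i hi => ?_))
    rw [funext hi]

/-- The underlying set of the reduced product `∏ M i / F`. -/
def ReducedProduct {I : Type*} (F : Filter I) (M : I → Type*) : Type _ :=
  F.Product M

/-- Functions act coordinatewise on representatives; a relation holds of a tuple of classes iff it
holds coordinatewise for `F`-many indices. -/
instance ReducedProduct.instStructure {L : FirstOrder.Language.{u, v}} {I : Type*} (F : Filter I)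
    (M : I → Type*) [∀ i, L.Structure (M i)] : L.Structure (ReducedProduct F M) :=
  @quotientStructure L (∀ i, M i) (F.productSetoid M) (productPrestructure F M)

/-- The underlying set of the reduced power `M ^ F`. -/
abbrev ReducedPower {I : Type*} (F : Filter I) (M : Type*) : Type _ :=
  ReducedProduct F fun _ : I => M

/-- The underlying set of the cartesian product `∏ M i`. -/
def CartesianProduct {I : Type*} (M : I → Type*) : Type _ :=
  ∀ i, M i

/-- Functions and relations of a cartesian product are coordinatewise. -/
instance CartesianProduct.instStructure {L : FirstOrder.Language.{u, v}} {I : Type*} (M : I → Type*)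
    [∀ i, L.Structure (M i)] : L.Structure (CartesianProduct M) where
  funMap := fun {_} f x i => Structure.funMap f fun k => x k i
  RelMap := fun {_} R x => ∀ i, Structure.RelMap R fun k => x k i

end Products

section Preservation

/-! Structures are non-empty, filters are proper (`F.NeBot`), and `w` is the universe of the
structures and of the index sets. -/

/-- Preservation of a theory under reduced products. -/
def PreservedUnderReducedProducts {L : FirstOrder.Language.{u, v}} (T : L.Theory) : Prop :=
  ∀ (I : Type w) (F : Filter I) [F.NeBot] (M : I → Type w) [∀ i, L.Structure (M i)]
    [∀ i, Nonempty (M i)], (∀ᶠ i in F, M i ⊨ T) → ReducedProduct F M ⊨ T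

/-- Copreservation of a theory under reduced products. -/
def CopreservedUnderReducedProducts {L : FirstOrder.Language.{u, v}} (T : L.Theory) : Prop :=
  ∀ (I : Type w) (F : Filter I) [F.NeBot] (M : I → Type w) [∀ i, L.Structure (M i)]
    [∀ i, Nonempty (M i)], ReducedProduct F M ⊨ T → ∀ᶠ i in F, M i ⊨ T

/-- Preservation of a theory under reduced roots. -/
def PreservedUnderReducedRoots {L : FirstOrder.Language.{u, v}} (T : L.Theory) : Prop :=
  ∀ (I : Type w) (F : Filter I) [F.NeBot] (M : Type w) [L.Structure M] [Nonempty M],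
    ReducedPower F M ⊨ T → M ⊨ T

/-- Preservation of a theory under (arbitrary) cartesian factors. -/
def PreservedUnderCartesianFactors {L : FirstOrder.Language.{u, v}} (T : L.Theory) : Prop :=
  ∀ (I : Type w) (M : I → Type w) [∀ i, L.Structure (M i)] [∀ i, Nonempty (M i)],
    CartesianProduct M ⊨ T → ∀ i, M i ⊨ T

/-- Preservation of a theory under finite cartesian factors. -/
def PreservedUnderFiniteCartesianFactors {L : FirstOrder.Language.{u, v}} (T : L.Theory) : Prop :=
  ∀ (I : Type w) [Finite I] (M : I → Type w) [∀ i, L.Structure (M i)] [∀ i, Nonempty (M i)],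
    CartesianProduct M ⊨ T → ∀ i, M i ⊨ T

/-- The theory `{φ(x)}` in the language `L(x)`, that is `L` with the free variables of `φ` added as
new constant symbols. -/
def formulaTheory {L : FirstOrder.Language.{u, v}} {α : Type*} (φ : L.Formula α) : L[[α]].Theory :=
  {Formula.equivSentence φ}

/-- A formula is bipreserved under reduced products if the theory `{φ(x)}` is both preserved and
copreserved. -/
def BipreservedUnderReducedProducts {L : FirstOrder.Language.{u, v}} {α : Type x} (φ : L.Formula α) : Prop :=
  PreservedUnderReducedProducts.{_, _, w} (formulaTheory φ) ∧
    CopreservedUnderReducedProducts.{_, _, w} (formulaTheory φ)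

end Preservation

section Formulas

/-- The smallest set of formulas that contains the atomic ones and is closed under conjunction, both
quantifiers and `φ, ψ ↦ (∃ x, φ) ∧ ∀ x, (φ → ψ)`. -/
inductive IsPalyutin {L : FirstOrder.Language.{u, v}} {α : Type*} : ∀ {n : ℕ}, L.BoundedFormula α n → Prop
  | atomic {n : ℕ} {φ : L.BoundedFormula α n} (h : φ.IsAtomic) : IsPalyutin φ
  | conj {n : ℕ} {φ ψ : L.BoundedFormula α n} (h₁ : IsPalyutin φ) (h₂ : IsPalyutin ψ) :
      IsPalyutin (φ ⊓ ψ)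
  | ex {n : ℕ} {φ : L.BoundedFormula α (n + 1)} (h : IsPalyutin φ) : IsPalyutin φ.ex
  | all {n : ℕ} {φ : L.BoundedFormula α (n + 1)} (h : IsPalyutin φ) : IsPalyutin φ.all
  | hop {n : ℕ} {φ ψ : L.BoundedFormula α (n + 1)} (h₁ : IsPalyutin φ) (h₂ : IsPalyutin ψ) :
      IsPalyutin (φ.ex ⊓ (φ.imp ψ).all)

/-- Some set of Palyutin sentences has the same models as `T`. -/
def AxiomatisableByPalyutin {L : FirstOrder.Language.{u, v}} (T : L.Theory) : Prop :=
  ∃ S : L.Theory, (∀ σ ∈ S, IsPalyutin σ) ∧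
    ∀ (M : Type w) [L.Structure M] [Nonempty M], M ⊨ T ↔ M ⊨ S

end Formulas

end Palyutin

/-! Palyutin formulas obey Łoś's theorem for every filter, which gives the easy directions. For the
converse, in a reduced power by the Fréchet filter on `ℕ` finitely many positive sets can be shrunk
to disjoint positive ones. Solutions of `h` that each avoid one `g` can then be glued into a
solution avoiding all of them (`SplitsFilter.splitting`). So "some x satisfies `h` and no `g`"
reduces to `∃ x, h` together with the failure of each `(∃ x, h) ∧ ∀ x, (h → g)`. By induction,
finitely many Palyutin formulas determine any given formula in such powers
(`exists_list_determining`).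

Let `N` be a model of `T` whose only true Palyutin sentences are consequences of `T`
(`exists_generic`), and let `M` satisfy all these consequences. Then `M × N` and `N` have the same
true Palyutin sentences, so their Fréchet powers are elementarily equivalent. The power of `N`
models `T`, hence so do the power of `M × N`, its root `M × N`, and its factor `M`. Part (2) is the
same argument with assignments; one formula involves only finitely many Palyutin formulas, so their
conjunction suffices. -/

namespace Palyutin

/-! ### Łoś's theorem for Palyutin formulas -/

section Los

variable {L : FirstOrder.Language.{u, v}} {I : Type*} {F : Filter I} {M : I → Type*}

/-- The class of a choice function in the reduced product. -/
def ReducedProduct.mk (F : Filter I) {M : I → Type*} (a : ∀ i, M i) : ReducedProduct F M :=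
  Quotient.mk (F.productSetoid M) a

theorem ReducedProduct.exists_rep (a : ReducedProduct F M) : ∃ b, ReducedProduct.mk F b = a :=
  Quotient.exists_rep (s := F.productSetoid M) a

theorem ReducedProduct.mk_eq_mk {a b : ∀ i, M i} :
    ReducedProduct.mk F a = ReducedProduct.mk F b ↔ ∀ᶠ i in F, a i = b i :=
  Quotient.eq (r := F.productSetoid M)

instance ReducedProduct.instNonempty [∀ i, Nonempty (M i)] : Nonempty (ReducedProduct F M) :=
  ⟨ReducedProduct.mk F fun _ => Classical.arbitrary _⟩

variable [∀ i, L.Structure (M i)]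

theorem ReducedProduct.funMap_mk {n : ℕ} (f : L.Functions n) (x : Fin n → ∀ i, M i) :
    Structure.funMap f (fun k => ReducedProduct.mk F (x k)) =
      ReducedProduct.mk F fun i => Structure.funMap f fun k => x k i :=
  @funMap_quotient_mk' L _ (F.productSetoid M) (productPrestructure F M) n f x

theorem ReducedProduct.relMap_mk {n : ℕ} (R : L.Relations n) (x : Fin n → ∀ i, M i) :
    Structure.RelMap R (fun k => ReducedProduct.mk F (x k)) ↔
      ∀ᶠ i in F, Structure.RelMap R fun k => x k i :=
  @relMap_quotient_mk' L _ (F.productSetoid M) (productPrestructure F M) n R x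

theorem ReducedProduct.realize_term {β : Type*} (t : L.Term β) (x : β → ∀ i, M i) :
    t.realize (fun b => ReducedProduct.mk F (x b)) =
      ReducedProduct.mk F fun i => t.realize fun b => x b i := by
  induction t with
  | var => rfl
  | func f ts ih => simp only [Term.realize, ih, ReducedProduct.funMap_mk]

theorem snoc_mk {n : ℕ} (xs : Fin n → ∀ i, M i) (a : ∀ i, M i) :
    (Fin.snoc (fun k => ReducedProduct.mk F (xs k)) (ReducedProduct.mk F a) :
      Fin (n + 1) → ReducedProduct F M) =
      fun k => ReducedProduct.mk F ((Fin.snoc xs a : Fin (n + 1) → ∀ i, M i) k) := by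
  funext k
  refine Fin.lastCases ?_ (fun k => ?_) k <;> simp

theorem snoc_apply_index {n : ℕ} (xs : Fin n → ∀ i, M i) (a : ∀ i, M i) (i : I) :
    (fun k => (Fin.snoc xs a : Fin (n + 1) → ∀ i, M i) k i) =
      (Fin.snoc (fun k => xs k i) (a i) : Fin (n + 1) → M i) := by
  funext k
  refine Fin.lastCases ?_ (fun k => ?_) k <;> simp

theorem ReducedProduct.elim_mk {α : Type*} {n : ℕ} (v : α → ∀ i, M i) (xs : Fin n → ∀ i, M i) :
    Sum.elim (fun a => ReducedProduct.mk F (v a)) (fun k => ReducedProduct.mk F (xs k)) =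
      fun b => ReducedProduct.mk F (Sum.elim v xs b) := by
  funext b
  cases b <;> rfl

theorem elim_apply_index {α : Type*} {n : ℕ} (v : α → ∀ i, M i) (xs : Fin n → ∀ i, M i) (i : I) :
    (fun b => Sum.elim v xs b i) = Sum.elim (fun a => v a i) (fun k => xs k i) := by
  funext b
  cases b <;> rfl

theorem ReducedProduct.realize_isAtomic {α : Type*} {n : ℕ} {φ : L.BoundedFormula α n}
    (hφ : φ.IsAtomic) (v : α → ∀ i, M i) (xs : Fin n → ∀ i, M i) :
    φ.Realize (fun a => ReducedProduct.mk F (v a)) (fun k => ReducedProduct.mk F (xs k)) ↔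
      ∀ᶠ i in F, φ.Realize (fun a => v a i) fun k => xs k i := by
  cases hφ with
  | equal t₁ t₂ =>
    simp only [BoundedFormula.realize_bdEqual, ReducedProduct.elim_mk,
      ReducedProduct.realize_term, ReducedProduct.mk_eq_mk, elim_apply_index]
  | rel R ts =>
    simp only [BoundedFormula.realize_rel, ReducedProduct.elim_mk,
      ReducedProduct.realize_term, ReducedProduct.relMap_mk, elim_apply_index]

/-- Łoś's theorem for Palyutin formulas: it holds for arbitrary filters. -/
theorem IsPalyutin.realize_reducedProduct [∀ i, Nonempty (M i)] {α : Type*} {n : ℕ}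
    {φ : L.BoundedFormula α n} (hφ : IsPalyutin φ) (v : α → ∀ i, M i) (xs : Fin n → ∀ i, M i) :
    φ.Realize (fun a => ReducedProduct.mk F (v a)) (fun k => ReducedProduct.mk F (xs k)) ↔
      ∀ᶠ i in F, φ.Realize (fun a => v a i) fun k => xs k i := by
  induction hφ with
  | atomic h => exact ReducedProduct.realize_isAtomic h v xs
  | conj _ _ ih₁ ih₂ => simp only [BoundedFormula.realize_inf, ih₁, ih₂, Filter.eventually_and]
  | ex _ ih =>
    simp only [BoundedFormula.realize_ex]
    constructor
    · rintro ⟨a, ha⟩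
      obtain ⟨a, rfl⟩ := a.exists_rep
      rw [snoc_mk, ih] at ha
      exact ha.mono fun i hi => ⟨a i, by rwa [snoc_apply_index] at hi⟩
    · intro h
      obtain ⟨a, ha⟩ := Filter.skolem.1 h
      refine ⟨ReducedProduct.mk F a, ?_⟩
      rw [snoc_mk, ih]
      exact ha.mono fun i hi => by rwa [snoc_apply_index]
  | @all n φ _ ih =>
    simp only [BoundedFormula.realize_all]
    constructor
    · intro h
      -- Take a counterexample at each coordinate that has one: this single class tests the
      -- universal statement everywhere.
      have key : ∀ i, ∃ a, φ.Realize (fun a => v a i) (Fin.snoc (fun k => xs k i) a) →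
          ∀ a, φ.Realize (fun a => v a i) (Fin.snoc (fun k => xs k i) a) := fun i => by
        by_contra! hc
        exact (hc (Classical.arbitrary _)).2.elim fun b hb => hb (hc b).1
      choose a ha using key
      have := h (ReducedProduct.mk F a)
      rw [snoc_mk, ih] at this
      exact this.mono fun i hi => ha i (by rwa [snoc_apply_index] at hi)
    · intro h a
      obtain ⟨a, rfl⟩ := a.exists_rep
      rw [snoc_mk, ih]
      exact h.mono fun i hi => by rw [snoc_apply_index]; exact hi _
  | @hop n φ ψ _ _ ih₁ ih₂ =>
    simp only [BoundedFormula.realize_inf, BoundedFormula.realize_ex, BoundedFormula.realize_all,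
      BoundedFormula.realize_imp]
    constructor
    · rintro ⟨⟨c, hc⟩, h⟩
      obtain ⟨c, rfl⟩ := c.exists_rep
      rw [snoc_mk, ih₁] at hc
      -- The test class is a counterexample to `φ → ψ` where one exists and `c i` elsewhere. The
      -- solution `c` from the existential conjunct keeps `φ` true for `F`-many indices, so the
      -- implication applies to it.
      have key : ∀ i, ∃ a, φ.Realize (fun a => v a i) (Fin.snoc (fun k => xs k i) (c i)) →
          φ.Realize (fun a => v a i) (Fin.snoc (fun k => xs k i) a) ∧
          (ψ.Realize (fun a => v a i) (Fin.snoc (fun k => xs k i) a) →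
          ∀ a, φ.Realize (fun a => v a i) (Fin.snoc (fun k => xs k i) a) →
            ψ.Realize (fun a => v a i) (Fin.snoc (fun k => xs k i) a)) := fun i => by
        by_cases hb : ∃ b, φ.Realize (fun a => v a i) (Fin.snoc (fun k => xs k i) b) ∧
            ¬ ψ.Realize (fun a => v a i) (Fin.snoc (fun k => xs k i) b)
        · obtain ⟨b, hb₁, hb₂⟩ := hb
          exact ⟨b, fun _ => ⟨hb₁, fun h => absurd h hb₂⟩⟩
        · push Not at hb
          exact ⟨c i, fun h => ⟨h, fun _ => hb⟩⟩
      choose a ha using key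
      simp only [snoc_apply_index] at hc
      have ha' := h (ReducedProduct.mk F a)
      rw [snoc_mk, ih₁, ih₂] at ha'
      simp only [snoc_apply_index] at ha'
      filter_upwards [hc, ha' (hc.mono fun i hi => (ha i hi).1)] with i h₁ h₂
      exact ⟨⟨_, h₁⟩, (ha i h₁).2 h₂⟩
    · intro h
      constructor
      · obtain ⟨a, ha⟩ := Filter.skolem.1 (h.mono fun i hi => hi.1)
        refine ⟨ReducedProduct.mk F a, ?_⟩
        rw [snoc_mk, ih₁]
        exact ha.mono fun i hi => by rwa [snoc_apply_index]
      · intro a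
        obtain ⟨a, rfl⟩ := a.exists_rep
        rw [snoc_mk, ih₁, ih₂]
        simp only [snoc_apply_index]
        intro ha
        filter_upwards [h, ha] with i h₁ h₂
        exact h₁.2 _ h₂

theorem IsPalyutin.realize_formula_reducedProduct [∀ i, Nonempty (M i)] {α : Type*}
    {φ : L.Formula α} (hφ : IsPalyutin φ) (v : α → ∀ i, M i) :
    φ.Realize (fun a => ReducedProduct.mk F (v a)) ↔ ∀ᶠ i in F, φ.Realize fun a => v a i := by
  have h := hφ.realize_reducedProduct (F := F) v (fun k => k.elim0)
  simpa only [Formula.Realize, Subsingleton.elim _ (default : Fin 0 → _)] using h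

theorem IsPalyutin.realize_sentence_reducedProduct [∀ i, Nonempty (M i)] {σ : L.Sentence}
    (hσ : IsPalyutin σ) : ReducedProduct F M ⊨ σ ↔ ∀ᶠ i in F, M i ⊨ σ := by
  have h := hσ.realize_formula_reducedProduct (F := F) (M := M) (fun k => k.elim)
  simpa only [Sentence.Realize, Subsingleton.elim _ (default : Empty → _)] using h

end Los

/-! ### Cartesian products as reduced products -/

section Cartesian

variable {L : FirstOrder.Language.{u, v}} {I : Type*}

/-- The cartesian product is the reduced product by the trivial filter. -/
noncomputable def cartesianProductEquiv (M : I → Type*) [∀ i, L.Structure (M i)] :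
    CartesianProduct M ≃[L] ReducedProduct (⊤ : Filter I) M where
  toEquiv := Equiv.ofBijective (fun a => ReducedProduct.mk ⊤ a)
    ⟨fun a b h => funext (by simpa using ReducedProduct.mk_eq_mk.1 h),
      ReducedProduct.exists_rep⟩
  map_fun' f x := (ReducedProduct.funMap_mk f x).symm
  map_rel' R x := (ReducedProduct.relMap_mk R x).trans Filter.eventually_top

instance CartesianProduct.instNonempty (M : I → Type*) [∀ i, Nonempty (M i)] :
    Nonempty (CartesianProduct M) :=
  ⟨fun _ => Classical.arbitrary _⟩

theorem IsPalyutin.realize_cartesianProduct {M : I → Type*} [∀ i, L.Structure (M i)]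
    [∀ i, Nonempty (M i)] {σ : L.Sentence} (hσ : IsPalyutin σ) :
    CartesianProduct M ⊨ σ ↔ ∀ i, M i ⊨ σ := by
  rw [StrongHomClass.realize_sentence (cartesianProductEquiv M), ← Filter.eventually_top]
  exact realize_sentence_reducedProduct hσ

end Cartesian

/-! ### Finite conjunctions -/

section Conjunction

variable {L : FirstOrder.Language.{u, v}} {α : Type*} {n : ℕ}

/-- A valid Palyutin formula. -/
def validity : L.BoundedFormula α n :=
  BoundedFormula.all (Term.bdEqual (Term.var (Sum.inr (Fin.last n)))
    (Term.var (Sum.inr (Fin.last n))))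

/-- The conjunction of a list of formulas, a Palyutin formula when all members are. -/
def listConj (l : List (L.BoundedFormula α n)) : L.BoundedFormula α n :=
  -- The base is not `⊤`, which is built from falsity.
  l.foldr (· ⊓ ·) validity

theorem isPalyutin_listConj {l : List (L.BoundedFormula α n)} (h : ∀ φ ∈ l, IsPalyutin φ) :
    IsPalyutin (listConj l) := by
  induction l with
  | nil => exact .all (.atomic (.equal _ _))
  | cons φ l ih =>
    exact .conj (h φ List.mem_cons_self) (ih fun ψ hψ => h ψ (List.mem_cons_of_mem φ hψ))

theorem realize_listConj {A : Type*} [L.Structure A] {l : List (L.BoundedFormula α n)}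
    {v : α → A} {xs : Fin n → A} :
    (listConj l).Realize v xs ↔ ∀ φ ∈ l, φ.Realize v xs := by
  induction l with
  | nil => simp [listConj, validity]
  | cons φ l ih =>
    rw [List.forall_mem_cons, ← ih]
    exact BoundedFormula.realize_inf

end Conjunction

/-! ### Elimination down to Palyutin formulas in Fréchet powers -/

section Splitting

/-- Solutions of a Palyutin formula that avoid one Palyutin formula each can be merged. -/
def Splitting (L : FirstOrder.Language.{u, v}) (α : Type*) (A : Type*) [L.Structure A] : Prop :=
  ∀ ⦃n : ℕ⦄ (h : L.BoundedFormula α (n + 1)) (l : List (L.BoundedFormula α (n + 1))),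
    IsPalyutin h → (∀ g ∈ l, IsPalyutin g) → ∀ (v : α → A) (xs : Fin n → A),
    (∃ a, h.Realize v (Fin.snoc xs a)) →
    (∀ g ∈ l, ∃ a, h.Realize v (Fin.snoc xs a) ∧ ¬ g.Realize v (Fin.snoc xs a)) →
    ∃ a, h.Realize v (Fin.snoc xs a) ∧ ∀ g ∈ l, ¬ g.Realize v (Fin.snoc xs a)

open Classical in
/-- One direction of the back-and-forth step: an existential quantifier is decided by finitely many
Palyutin formulas. -/
theorem Splitting.exists_transfer {L : FirstOrder.Language.{u, v}} {α A B : Type*} [L.Structure A]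
    [L.Structure B] (hB : Splitting L α B) {n : ℕ}
    {l : List (L.BoundedFormula α (n + 1))} (hl : ∀ σ ∈ l, IsPalyutin σ)
    {v : α → A} {xs : Fin n → A} {v' : α → B} {xs' : Fin n → B}
    (hex : ∀ s ∈ l.sublists, (listConj s).ex.Realize v xs ↔ (listConj s).ex.Realize v' xs')
    (hhop : ∀ s ∈ l.sublists, ∀ g ∈ l,
      ((listConj s).ex ⊓ ((listConj s).imp g).all).Realize v xs ↔
        ((listConj s).ex ⊓ ((listConj s).imp g).all).Realize v' xs') (a : A) :
    ∃ b, ∀ σ ∈ l, σ.Realize v (Fin.snoc xs a) ↔ σ.Realize v' (Fin.snoc xs' b) := by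
  set s := l.filter fun σ => σ.Realize v (Fin.snoc xs a) with hs
  have hsl : s ∈ l.sublists := List.mem_sublists.2 List.filter_sublist
  have hsP : IsPalyutin (listConj s) :=
    isPalyutin_listConj fun σ hσ => hl σ (List.mem_of_mem_filter hσ)
  have ha : (listConj s).Realize v (Fin.snoc xs a) :=
    realize_listConj.2 fun σ hσ => by simpa using (List.mem_filter.1 hσ).2
  have hexB : ∃ b, (listConj s).Realize v' (Fin.snoc xs' b) :=
    BoundedFormula.realize_ex.1 ((hex s hsl).1 (BoundedFormula.realize_ex.2 ⟨a, ha⟩))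
  -- Here `h` is the conjunction of what is true at `a`, and the formulas to avoid are those false
  -- at `a`. For each such `g`, `a` refutes the implication in `A`, so the transferred formula fails
  -- in `B`; its existential part holds there, so its universal part fails.
  obtain ⟨b, hb, hb'⟩ := hB (listConj s) (l.filter fun σ => ¬ σ.Realize v (Fin.snoc xs a)) hsP
    (fun σ hσ => hl σ (List.mem_of_mem_filter hσ)) v' xs' hexB fun g hg => by
      obtain ⟨hgl, hga⟩ := List.mem_filter.1 hg
      have h := (not_congr (hhop s hsl g hgl)).1 fun h => by
        simp only [BoundedFormula.realize_inf, BoundedFormula.realize_all,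
          BoundedFormula.realize_imp] at h
        exact (by simpa using hga : ¬ _) (h.2 a ha)
      simp only [BoundedFormula.realize_inf, BoundedFormula.realize_ex,
        BoundedFormula.realize_all, BoundedFormula.realize_imp, not_and, not_forall] at h
      obtain ⟨b, hb, hb'⟩ := h hexB
      exact ⟨b, hb, hb'⟩
  refine ⟨b, fun σ hσ => ⟨fun h => ?_, fun h => ?_⟩⟩
  · exact realize_listConj.1 hb σ (List.mem_filter.2 ⟨hσ, by simpa using h⟩)
  · by_contra hc
    exact hb' σ (List.mem_filter.2 ⟨hσ, by simpa using hc⟩) h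

/-- In structures with splitting, every formula is determined by finitely many Palyutin formulas. -/
theorem exists_list_determining {L : FirstOrder.Language.{u, v}} {α : Type*} {n : ℕ}
    (φ : L.BoundedFormula α n) :
    ∃ l : List (L.BoundedFormula α n), (∀ σ ∈ l, IsPalyutin σ) ∧
      ∀ (A B : Type w) [L.Structure A] [L.Structure B], Splitting L α A → Splitting L α B →
        ∀ (v : α → A) (xs : Fin n → A) (v' : α → B) (xs' : Fin n → B),
          (∀ σ ∈ l, σ.Realize v xs ↔ σ.Realize v' xs') → (φ.Realize v xs ↔ φ.Realize v' xs') := by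
  induction φ with
  | falsum => exact ⟨[], by simp, fun A B _ _ _ _ v xs v' xs' _ => Iff.rfl⟩
  | equal t₁ t₂ =>
    exact ⟨[.equal t₁ t₂], by simpa using .atomic (.equal t₁ t₂),
      fun A B _ _ _ _ v xs v' xs' h => h _ List.mem_cons_self⟩
  | rel R ts =>
    exact ⟨[.rel R ts], by simpa using .atomic (.rel R ts),
      fun A B _ _ _ _ v xs v' xs' h => h _ List.mem_cons_self⟩
  | imp φ ψ ih₁ ih₂ =>
    obtain ⟨l₁, hl₁, h₁⟩ := ih₁
    obtain ⟨l₂, hl₂, h₂⟩ := ih₂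
    refine ⟨l₁ ++ l₂, fun σ hσ => (List.mem_append.1 hσ).elim (hl₁ σ) (hl₂ σ),
      fun A B _ _ hA hB v xs v' xs' h => ?_⟩
    rw [BoundedFormula.realize_imp, BoundedFormula.realize_imp,
      h₁ A B hA hB v xs v' xs' fun σ hσ => h σ (List.mem_append_left _ hσ),
      h₂ A B hA hB v xs v' xs' fun σ hσ => h σ (List.mem_append_right _ hσ)]
  | all φ ih =>
    obtain ⟨l, hl, hφ⟩ := ih
    have hc : ∀ s ∈ l.sublists, IsPalyutin (listConj s) := fun s hs =>
      isPalyutin_listConj fun σ hσ => hl σ ((List.mem_sublists.1 hs).subset hσ)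
    -- All sublists are needed, since the set of formulas true at the chosen element is not known in
    -- advance.
    refine ⟨l.sublists.map (fun s => (listConj s).ex) ++ l.sublists.flatMap (fun s =>
      l.map fun g => (listConj s).ex ⊓ ((listConj s).imp g).all), ?_,
      fun A B _ _ hA hB v xs v' xs' h => ?_⟩
    · intro σ hσ
      rcases List.mem_append.1 hσ with hσ | hσ
      · obtain ⟨s, hs, rfl⟩ := List.mem_map.1 hσ
        exact .ex (hc s hs)
      · obtain ⟨s, hs, hσ⟩ := List.mem_flatMap.1 hσ
        obtain ⟨g, hg, rfl⟩ := List.mem_map.1 hσ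
        exact .hop (hc s hs) (hl g hg)
    · have hex : ∀ s ∈ l.sublists,
          ((listConj s).ex.Realize v xs ↔ (listConj s).ex.Realize v' xs') := fun s hs =>
        h _ (List.mem_append_left _ (List.mem_map.2 ⟨s, hs, rfl⟩))
      have hhop : ∀ s ∈ l.sublists, ∀ g ∈ l,
          (((listConj s).ex ⊓ ((listConj s).imp g).all).Realize v xs ↔
            ((listConj s).ex ⊓ ((listConj s).imp g).all).Realize v' xs') := fun s hs g hg =>
        h _ (List.mem_append_right _ (List.mem_flatMap.2 ⟨s, hs, List.mem_map.2 ⟨g, hg, rfl⟩⟩))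
      rw [BoundedFormula.realize_all, BoundedFormula.realize_all]
      constructor
      · intro H b
        obtain ⟨a, ha⟩ := hA.exists_transfer hl (fun s hs => (hex s hs).symm)
          (fun s hs g hg => (hhop s hs g hg).symm) b
        exact (hφ B A hB hA v' _ v _ ha).2 (H a)
      · intro H a
        obtain ⟨b, hb⟩ := hB.exists_transfer hl hex hhop a
        exact (hφ A B hA hB v _ v' _ hb).2 (H b)

/-- Countably many positive sets of the filter can be shrunk to pairwise disjoint positive sets. -/
def SplitsFilter {I : Type*} (F : Filter I) : Prop :=
  ∀ P : ℕ → I → Prop, (∀ j, ∃ᶠ i in F, P j i) → ∃ c : I → ℕ, ∀ j, ∃ᶠ i in F, c i = j ∧ P j i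

/-- Pick points `e m` in strictly increasing order, the `m`-th one in the set numbered by the first
component of `unpair m`. Each set is served infinitely often and no point is used twice. -/
theorem splitsFilter_atTop : SplitsFilter (Filter.atTop : Filter ℕ) := by
  intro P hP
  obtain ⟨e, he, heP⟩ := Filter.extraction_forall_of_frequently
    (P := fun m i => P (Nat.unpair m).1 i) fun m => hP _
  refine ⟨fun i => (Nat.unpair (Function.invFun e i)).1, fun j => ?_⟩
  refine Filter.frequently_atTop.2 fun a => ⟨e (Nat.pair j a), ?_, ?_, ?_⟩
  · exact (Nat.right_le_pair j a).trans he.le_apply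
  · simp [Function.leftInverse_invFun he.injective _]
  · simpa using heP (Nat.pair j a)

/-- The Fréchet filter on a copy of `ℕ` in an arbitrary universe. -/
def frechet : Filter (ULift.{w} ℕ) :=
  Filter.atTop.map ULift.up

instance frechet_neBot : frechet.{w}.NeBot :=
  inferInstanceAs (Filter.atTop.map ULift.up).NeBot

theorem splitsFilter_frechet : SplitsFilter frechet.{w} := by
  intro P hP
  obtain ⟨c, hc⟩ := splitsFilter_atTop (fun j i => P j ⟨i⟩) fun j => Filter.frequently_map.1 (hP j)
  exact ⟨fun i => c i.down, fun j => Filter.frequently_map.2 (hc j)⟩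

/-- Glue the given solutions along disjoint positive blocks. Finitely many solutions are involved,
so `h` holds for all of them at `F`-many indices, while each `g` fails on its own block. -/
theorem SplitsFilter.splitting {L : FirstOrder.Language.{u, v}} {α : Type*} {I : Type*}
    {F : Filter I} (hF : SplitsFilter F) (M : I → Type*) [∀ i, L.Structure (M i)]
    [∀ i, Nonempty (M i)] : Splitting L α (ReducedProduct F M) := by
  intro n h l hh hl v xs hex hneg
  obtain ⟨v, rfl⟩ : ∃ v₀ : α → ∀ i, M i, v = fun a => ReducedProduct.mk F (v₀ a) :=
    ⟨fun a => (v a).exists_rep.choose, funext fun a => (v a).exists_rep.choose_spec.symm⟩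
  obtain ⟨xs, rfl⟩ : ∃ xs₀ : Fin n → ∀ i, M i, xs = fun k => ReducedProduct.mk F (xs₀ k) :=
    ⟨fun k => (xs k).exists_rep.choose, funext fun k => (xs k).exists_rep.choose_spec.symm⟩
  by_cases hl0 : l = []
  · subst hl0
    simpa using hex
  have realize_snoc : ∀ {φ : L.BoundedFormula α (n + 1)}, IsPalyutin φ → ∀ a : ∀ i, M i,
      φ.Realize (fun a => ReducedProduct.mk F (v a))
        (Fin.snoc (fun k => ReducedProduct.mk F (xs k)) (ReducedProduct.mk F a)) ↔
      ∀ᶠ i in F, φ.Realize (fun a => v a i) (Fin.snoc (fun k => xs k i) (a i)) := fun hφ a => by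
    rw [snoc_mk, hφ.realize_reducedProduct]
    simp only [snoc_apply_index]
  have key : ∀ g ∈ l, ∃ a : ∀ i, M i,
      (∀ᶠ i in F, h.Realize (fun a => v a i) (Fin.snoc (fun k => xs k i) (a i))) ∧
      ∃ᶠ i in F, ¬ g.Realize (fun a => v a i) (Fin.snoc (fun k => xs k i) (a i)) := fun g hg => by
    obtain ⟨a, ha, hga⟩ := hneg g hg
    obtain ⟨a, rfl⟩ := a.exists_rep
    rw [realize_snoc hh] at ha
    rw [realize_snoc (hl g hg), Filter.not_eventually] at hga
    exact ⟨a, ha, hga⟩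
  have hpos : 0 < l.length := List.length_pos_iff.2 hl0
  have hmod : ∀ j, j % l.length < l.length := fun j => Nat.mod_lt _ hpos
  -- Reading the list cyclically gives the `ℕ`-indexed family that `SplitsFilter` expects.
  choose b hb hgb using fun j : ℕ => key (l[j % l.length]'(hmod j)) (List.getElem_mem _)
  obtain ⟨c, hc⟩ := hF _ hgb
  refine ⟨ReducedProduct.mk F fun i => b (c i % l.length) i, ?_, fun g hg => ?_⟩
  · rw [realize_snoc hh]
    have : ∀ᶠ i in F, ∀ j : Fin l.length,
        h.Realize (fun a => v a i) (Fin.snoc (fun k => xs k i) (b j i)) :=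
      Filter.eventually_all.2 fun j => hb j
    exact this.mono fun i hi => hi ⟨_, hmod _⟩
  · rw [realize_snoc (hl g hg), Filter.not_eventually]
    obtain ⟨j, hj, rfl⟩ := List.getElem_of_mem hg
    refine (hc j).mono fun i ⟨hi, hi'⟩ => ?_
    simpa only [hi, Nat.mod_eq_of_lt hj] using hi'

end Splitting

/-! ### Generic members of classes closed under products -/

section Generic

/-- A class of pointed structures closed under products has a member that satisfies no Palyutin
formulas beyond the consequences of the class. -/
theorem exists_generic {L : FirstOrder.Language.{u, v}} {α : Type x}
    (C : ∀ (N : Type max u v w x) [L.Structure N], (α → N) → Prop)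
    (hC : ∀ (I : Type max u v w x) (M : I → Type max u v w x) [∀ i, L.Structure (M i)]
      [∀ i, Nonempty (M i)] [Nonempty I] (v : α → ∀ i, M i), (∀ i, C (M i) fun a => v a i) →
        C (ReducedProduct (⊤ : Filter I) M) fun a => ReducedProduct.mk ⊤ (v a))
    (hne : ∃ (N : Type max u v w x) (_ : L.Structure N) (_ : Nonempty N) (v : α → N), C N v) :
    ∃ (N : Type max u v w x) (_ : L.Structure N) (_ : Nonempty N) (v : α → N), C N v ∧
      ∀ σ : L.Formula α, IsPalyutin σ → σ.Realize v →
        ∀ (N' : Type max u v w x) [L.Structure N'] [Nonempty N'] (v' : α → N'),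
          C N' v' → σ.Realize v' := by
  have key : ∀ σ : ULift.{max u v w x} (L.Formula α),
      ∃ (N : Type max u v w x) (_ : L.Structure N) (_ : Nonempty N) (v : α → N), C N v ∧
        (σ.down.Realize v → ∀ (N' : Type max u v w x) [L.Structure N'] [Nonempty N'] (v' : α → N'),
          C N' v' → σ.down.Realize v') := by
    intro σ
    -- For each formula choose a member refuting it, if there is one. In the product of all these
    -- members, a true Palyutin formula holds in its own factor, so it had no refutation.
    by_cases h : ∃ (N : Type max u v w x) (_ : L.Structure N) (_ : Nonempty N) (v : α → N),
        C N v ∧ ¬ σ.down.Realize v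
    · obtain ⟨N, _, _, v, hv, hσ⟩ := h
      exact ⟨N, _, ‹_›, v, hv, fun h => absurd h hσ⟩
    · obtain ⟨N, _, _, v, hv⟩ := hne
      refine ⟨N, _, ‹_›, v, hv, fun _ N' _ _ v' hv' => ?_⟩
      by_contra hc
      exact h ⟨N', _, ‹_›, v', hv', hc⟩
  choose N sN nN v hv hσ using key
  refine ⟨ReducedProduct (⊤ : Filter _) N, inferInstance, inferInstance,
    fun a => ReducedProduct.mk ⊤ fun i => v i a, hC _ N (fun a i => v i a) hv,
    fun σ hP h => hσ ⟨σ⟩ ?_⟩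
  rw [hP.realize_formula_reducedProduct, Filter.eventually_top] at h
  exact h ⟨σ⟩

end Generic

/-! ### Part (1): theories -/

section Theories

variable {L : FirstOrder.Language.{u, v}} {T : L.Theory}

/-- The family consisting of two given types. -/
def pairFamily (M N : Type w) (b : ULift.{w} Bool) : Type w :=
  bif b.down then M else N

instance pairFamily.instStructure (M N : Type w) [L.Structure M] [L.Structure N] :
    ∀ b, L.Structure (pairFamily M N b)
  | ⟨true⟩ => inferInstanceAs (L.Structure M)
  | ⟨false⟩ => inferInstanceAs (L.Structure N)

instance pairFamily.instNonempty (M N : Type w) [Nonempty M] [Nonempty N] :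
    ∀ b, Nonempty (pairFamily M N b)
  | ⟨true⟩ => inferInstanceAs (Nonempty M)
  | ⟨false⟩ => inferInstanceAs (Nonempty N)

/-- A structure and its reduced power satisfy the same Palyutin formulas, so agreement downstairs
lifts to the powers, where these formulas decide `φ`. -/
theorem realize_reducedPower_iff_of_agree {α : Type*} (φ : L.Formula α) :
    ∃ l : List (L.Formula α), (∀ σ ∈ l, IsPalyutin σ) ∧
      ∀ (A B : Type w) [L.Structure A] [L.Structure B] [Nonempty A] [Nonempty B]
        (v : α → A) (v' : α → B), (∀ σ ∈ l, σ.Realize v ↔ σ.Realize v') →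
          (φ.Realize (fun a => ReducedProduct.mk frechet.{w} fun _ => v a) ↔
            φ.Realize (fun a => ReducedProduct.mk frechet.{w} fun _ => v' a)) := by
  obtain ⟨l, hl, h⟩ := exists_list_determining.{u, v, w} φ
  refine ⟨l, hl, fun A B _ _ _ _ v v' hvv' => ?_⟩
  refine h _ _ (splitsFilter_frechet.splitting fun _ => A)
    (splitsFilter_frechet.splitting fun _ => B) _ _ _ _ fun σ hσ => ?_
  have h₁ := (hl σ hσ).realize_formula_reducedProduct (F := frechet.{w}) fun a _ => v a
  have h₂ := (hl σ hσ).realize_formula_reducedProduct (F := frechet.{w}) fun a _ => v' a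
  rw [Filter.eventually_const] at h₁ h₂
  have := h₁.trans ((hvv' σ hσ).trans h₂.symm)
  simpa only [Formula.Realize, Subsingleton.elim _ (default : Fin 0 → _)] using this

theorem AxiomatisableByPalyutin.preservedUnderReducedProducts
    (h : AxiomatisableByPalyutin.{u, v, w} T) : PreservedUnderReducedProducts.{u, v, w} T := by
  obtain ⟨S, hS, hT⟩ := h
  intro I F _ M _ _ hM
  rw [hT, Theory.model_iff]
  intro σ hσ
  rw [(hS σ hσ).realize_sentence_reducedProduct]
  exact hM.mono fun i hi => Theory.model_iff S |>.1 ((hT _).1 hi) σ hσ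

theorem AxiomatisableByPalyutin.preservedUnderReducedRoots
    (h : AxiomatisableByPalyutin.{u, v, w} T) : PreservedUnderReducedRoots.{u, v, w} T := by
  obtain ⟨S, hS, hT⟩ := h
  intro I F _ M _ _ hM
  rw [hT, Theory.model_iff] at hM ⊢
  exact fun σ hσ => Filter.eventually_const.1
    ((hS σ hσ).realize_sentence_reducedProduct.1 (hM σ hσ))

theorem AxiomatisableByPalyutin.preservedUnderCartesianFactors
    (h : AxiomatisableByPalyutin.{u, v, w} T) : PreservedUnderCartesianFactors.{u, v, w} T := by
  obtain ⟨S, hS, hT⟩ := h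
  intro I M _ _ hM i
  rw [hT, Theory.model_iff] at hM ⊢
  exact fun σ hσ => (hS σ hσ).realize_cartesianProduct.1 (hM σ hσ) i

theorem PreservedUnderCartesianFactors.finite (h : PreservedUnderCartesianFactors.{u, v, w} T) :
    PreservedUnderFiniteCartesianFactors.{u, v, w} T :=
  fun I _ M _ _ hM => h I M hM

theorem axiomatisableByPalyutin_of_preserved (hsat : T.IsSatisfiable)
    (hprod : PreservedUnderReducedProducts.{u, v, max u v w} T)
    (hroot : PreservedUnderReducedRoots.{u, v, max u v w} T)
    (hfac : PreservedUnderFiniteCartesianFactors.{u, v, max u v w} T) :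
    AxiomatisableByPalyutin.{u, v, max u v w} T := by
  refine ⟨{σ | IsPalyutin σ ∧ ∀ (N : Type max u v w) [L.Structure N] [Nonempty N],
    N ⊨ T → N ⊨ σ}, fun σ hσ => hσ.1, fun M _ _ => ⟨fun hM => ?_, fun hM => ?_⟩⟩
  · exact (Theory.model_iff _).2 fun σ hσ => hσ.2 M hM
  obtain ⟨N, _, _, v, hN, hgen⟩ := exists_generic.{u, v, w, 0} (L := L) (α := Empty)
    (fun N _ _ => N ⊨ T)
    (fun I M _ _ _ v hM => hprod I ⊤ M (Filter.Eventually.of_forall hM)) (by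
      obtain ⟨N⟩ := hsat
      let N' := Theory.ModelType.ulift.{u, v, max u v, max u v w} N
      exact ⟨N', inferInstance, inferInstance, fun e => e.elim, N'.is_model⟩)
  -- If `N ⊨ σ`, genericity makes `σ` a consequence of `T`, hence true in `M`.
  have agree : ∀ σ : L.Sentence, IsPalyutin σ →
      (CartesianProduct (pairFamily M N) ⊨ σ ↔ N ⊨ σ) := fun σ hσ => by
    rw [hσ.realize_cartesianProduct]
    refine ⟨fun h => h ⟨false⟩, fun h => ?_⟩
    rintro ⟨_ | _⟩
    · exact h
    · exact (Theory.model_iff _).1 hM σ ⟨hσ, fun N' _ _ hN' => by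
        have := hgen σ hσ (by rwa [Subsingleton.elim v default]) N' default hN'
        exact this⟩
  refine hfac (ULift Bool) (pairFamily M N)
    (hroot (ULift ℕ) frechet (CartesianProduct (pairFamily M N)) ?_) ⟨true⟩
  have hNF : ReducedPower frechet.{max u v w} N ⊨ T :=
    hprod _ frechet (fun _ => N) (Filter.Eventually.of_forall fun _ => hN)
  refine (Theory.model_iff _).2 fun τ hτ => ?_
  obtain ⟨l, hl, h⟩ := realize_reducedPower_iff_of_agree.{u, v, max u v w} τ
  have := h (CartesianProduct (pairFamily M N)) N default default fun σ hσ => agree σ (hl σ hσ)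
  have hτN := (Theory.model_iff _).1 hNF τ hτ
  simp only [Subsingleton.elim (fun a : Empty => _) default] at this
  exact this.2 hτN

end Theories

/-! ### Part (2): formulas, with constants traded for assignments -/

section PointedFormulas

variable {L : FirstOrder.Language.{u, v}} {α : Type x}

theorem model_formulaTheory {M : Type*} [L[[α]].Structure M] {φ : L.Formula α} :
    M ⊨ formulaTheory φ ↔ (Formula.equivSentence φ).Realize M := by
  simp [formulaTheory, Sentence.Realize]

theorem ReducedProduct.isExpansionOn {I : Type*} (F : Filter I) (M : I → Type*)
    [∀ i, L.Structure (M i)] [∀ i, L[[α]].Structure (M i)]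
    [∀ i, (L.lhomWithConstants α).IsExpansionOn (M i)] :
    (L.lhomWithConstants α).IsExpansionOn (ReducedProduct F M) where
  map_onFunction {n} f x := by
    obtain ⟨x, rfl⟩ : ∃ x₀ : Fin n → ∀ i, M i, x = fun k => ReducedProduct.mk F (x₀ k) :=
      ⟨fun k => (x k).exists_rep.choose, funext fun k => (x k).exists_rep.choose_spec.symm⟩
    simp only [ReducedProduct.funMap_mk, (L.lhomWithConstants α).map_onFunction]
  map_onRelation {n} R x := by
    obtain ⟨x, rfl⟩ : ∃ x₀ : Fin n → ∀ i, M i, x = fun k => ReducedProduct.mk F (x₀ k) :=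
      ⟨fun k => (x k).exists_rep.choose, funext fun k => (x k).exists_rep.choose_spec.symm⟩
    simp only [ReducedProduct.relMap_mk, (L.lhomWithConstants α).map_onRelation]

theorem ReducedProduct.coe_con {I : Type*} (F : Filter I) (M : I → Type*)
    [∀ i, L[[α]].Structure (M i)] (a : α) :
    (L.con a : ReducedProduct F M) = ReducedProduct.mk F fun i => (L.con a : M i) := by
  have h := ReducedProduct.funMap_mk (F := F) (M := M) (L := L[[α]]) (L.con a) (fun k => k.elim0)
  simp only [Subsingleton.elim (fun k : Fin 0 => _) default] at h
  exact h

theorem model_formulaTheory_reducedProduct {I : Type*} (F : Filter I) (M : I → Type*)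
    [∀ i, L.Structure (M i)] [∀ i, L[[α]].Structure (M i)]
    [∀ i, (L.lhomWithConstants α).IsExpansionOn (M i)] (φ : L.Formula α) :
    ReducedProduct F M ⊨ formulaTheory φ ↔
      φ.Realize fun a => ReducedProduct.mk F fun i => (L.con a : M i) := by
  have := ReducedProduct.isExpansionOn (L := L) (α := α) F M
  rw [model_formulaTheory, Formula.realize_equivSentence]
  simp only [ReducedProduct.coe_con]

/-- Bipreservation of a formula, expressed by assignments instead of new constants. -/
theorem bipreservedUnderReducedProducts_iff {φ : L.Formula α} :
    BipreservedUnderReducedProducts.{u, v, w, x} φ ↔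
      ∀ (I : Type w) (F : Filter I) [F.NeBot] (M : I → Type w) [∀ i, L.Structure (M i)]
        [∀ i, Nonempty (M i)] (v : α → ∀ i, M i),
          φ.Realize (fun a => ReducedProduct.mk F (v a)) ↔
            ∀ᶠ i in F, φ.Realize fun a => v a i := by
  constructor
  · rintro ⟨h₁, h₂⟩ I F _ M _ _ v
    let : ∀ i, (constantsOn α).Structure (M i) := fun i => constantsOn.structure fun a => v a i
    have hcon : ∀ i a, ((L.con a : L[[α]].Constants) : M i) = v a i := fun i a => rfl
    have key := model_formulaTheory_reducedProduct F M φ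
    simp only [hcon] at key
    rw [← key]
    have key' : ∀ i, M i ⊨ formulaTheory φ ↔ φ.Realize fun a => v a i := fun i => by
      rw [model_formulaTheory, Formula.realize_equivSentence]
      simp only [hcon]
    simp only [← key']
    exact ⟨h₂ I F M, h₁ I F M⟩
  · intro h
    have key : ∀ (I : Type w) (F : Filter I) [F.NeBot] (M : I → Type w) [∀ i, L[[α]].Structure (M i)]
        [∀ i, Nonempty (M i)],
        (ReducedProduct F M ⊨ formulaTheory φ ↔ ∀ᶠ i in F, M i ⊨ formulaTheory φ) := by
      intro I F _ M _ _
      let : ∀ i, L.Structure (M i) := fun i => (L.lhomWithConstants α).reduct (M i)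
      have : ∀ i, (L.lhomWithConstants α).IsExpansionOn (M i) := fun i => inferInstance
      rw [model_formulaTheory_reducedProduct]
      simp only [model_formulaTheory, Formula.realize_equivSentence]
      exact h I F M _
    exact ⟨fun I F _ M _ _ => (key I F M).2, fun I F _ M _ _ => (key I F M).1⟩

theorem exists_palyutin_of_bipreserved {φ : L.Formula α}
    (hsat : (formulaTheory φ).IsSatisfiable)
    (hφ : BipreservedUnderReducedProducts.{u, v, max u v w x, x} φ) :
    ∃ ψ : L.Formula α, IsPalyutin ψ ∧
      ∀ (M : Type max u v w x) [L.Structure M] [Nonempty M] (v : α → M),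
        φ.Realize v ↔ ψ.Realize v := by
  classical
  rw [bipreservedUnderReducedProducts_iff] at hφ
  obtain ⟨N, _, _, w, hN, hgen⟩ := exists_generic.{u, v, w, x} (L := L) (α := α)
    (fun N _ v => φ.Realize v)
    (fun I M _ _ _ v hM => (hφ I ⊤ M v).2 (Filter.Eventually.of_forall hM)) (by
      obtain ⟨N⟩ := hsat
      let N' := Theory.ModelType.ulift.{max u x, v, max u v x, max u v w x} N
      let : L.Structure N' := (L.lhomWithConstants α).reduct N'
      exact ⟨N', inferInstance, inferInstance, fun a => (L.con a : N'),
        (Formula.realize_equivSentence N' φ).1 (model_formulaTheory.1 N'.is_model)⟩)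
  obtain ⟨l, hl, hagree⟩ := realize_reducedPower_iff_of_agree.{u, v, max u v w x} φ
  -- Of the formulas that determine `φ` in Fréchet powers, keep those true at the generic
  -- assignment.
  refine ⟨listConj (l.filter fun σ => Formula.Realize σ w),
    isPalyutin_listConj fun σ hσ => hl σ (List.mem_of_mem_filter hσ), fun M _ _ v => ?_⟩
  have hconj : (listConj (l.filter fun σ => Formula.Realize σ w)).Realize v default ↔
      ∀ σ ∈ l, σ.Realize w → σ.Realize v := by
    rw [realize_listConj]
    simp only [List.mem_filter, decide_eq_true_eq, and_imp]
    rfl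
  refine Iff.trans ?_ hconj.symm
  refine ⟨fun h σ hσ hσw => hgen σ (hl σ hσ) hσw M v h, fun h => ?_⟩
  let p : α → ∀ b, pairFamily M N b := fun a b => match b with
    | ⟨true⟩ => v a
    | ⟨false⟩ => w a
  have hfactor := (hφ (ULift Bool) ⊤ (pairFamily M N) p).1
  rw [Filter.eventually_top] at hfactor
  refine hfactor ?_ ⟨true⟩
  have hpow : ∀ (A : Type max u v w x) [L.Structure A] [Nonempty A] (z : α → A),
      φ.Realize (fun a => ReducedProduct.mk frechet.{max u v w x} fun _ => z a) ↔ φ.Realize z :=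
    fun A _ _ z => (hφ _ frechet (fun _ => A) fun a _ => z a).trans Filter.eventually_const
  -- Pass from the product to its Fréchet power, across to that of `N`, and back down to `N`;
  -- bipreservation supplies the root step.
  rw [← hpow, hagree _ N _ w, hpow]
  · exact hN
  intro σ hσ
  rw [(hl σ hσ).realize_formula_reducedProduct, Filter.eventually_top]
  refine ⟨fun h => h ⟨false⟩, fun hσw => ?_⟩
  rintro ⟨_ | _⟩
  · exact hσw
  · exact h σ hσ hσw

theorem iff_empty_iff {φ ψ : L.Formula α} : (∅ : L.Theory).Iff φ ψ ↔
    ∀ (M : Type max u v x) [L.Structure M] [Nonempty M] (v : α → M),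
      φ.Realize v ↔ ψ.Realize v := by
  constructor
  · intro h M _ _ v
    exact BoundedFormula.realize_iff.1
      (Theory.ModelsBoundedFormula.realize_boundedFormula h M (v := v) (xs := default))
  · intro h
    refine Theory.models_formula_iff.2 fun M v => BoundedFormula.realize_iff.2 ?_
    exact h M v

end PointedFormulas

end Palyutin

/-- The universe `max u v w` has room for products indexed by all formulas, as the generic structure
requires. -/
theorem mainTheorem12 (L : FirstOrder.Language.{u, v}) :
    (∀ T : L.Theory, T.IsSatisfiable →
      ((Palyutin.PreservedUnderReducedProducts.{u, v, max u v w} T ∧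
          Palyutin.PreservedUnderReducedRoots.{u, v, max u v w} T ∧
          Palyutin.PreservedUnderCartesianFactors.{u, v, max u v w} T) ↔
        Palyutin.AxiomatisableByPalyutin.{u, v, max u v w} T) ∧
      ((Palyutin.PreservedUnderReducedProducts.{u, v, max u v w} T ∧
          Palyutin.PreservedUnderReducedRoots.{u, v, max u v w} T ∧
          Palyutin.PreservedUnderFiniteCartesianFactors.{u, v, max u v w} T) ↔
        Palyutin.AxiomatisableByPalyutin.{u, v, max u v w} T)) ∧
    (∀ (α : Type w) (φ : L.Formula α), (Palyutin.formulaTheory φ).IsSatisfiable →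
      (Palyutin.BipreservedUnderReducedProducts.{u, v, max u v w, w} φ ↔
        ∃ ψ : L.Formula α, Palyutin.IsPalyutin ψ ∧ (∅ : L.Theory).Iff φ ψ)) := by
  refine ⟨fun T hT => ⟨⟨fun ⟨h₁, h₂, h₃⟩ => ?_, fun h => ?_⟩, ⟨fun ⟨h₁, h₂, h₃⟩ => ?_, fun h => ?_⟩⟩,
    fun α φ hφ => ⟨fun h => ?_, fun ⟨ψ, hψ, h⟩ => ?_⟩⟩
  · exact Palyutin.axiomatisableByPalyutin_of_preserved.{u, v, w} hT h₁ h₂ h₃.finite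
  · exact ⟨h.preservedUnderReducedProducts, h.preservedUnderReducedRoots,
      h.preservedUnderCartesianFactors⟩
  · exact Palyutin.axiomatisableByPalyutin_of_preserved.{u, v, w} hT h₁ h₂ h₃
  · exact ⟨h.preservedUnderReducedProducts, h.preservedUnderReducedRoots,
      h.preservedUnderCartesianFactors.finite⟩
  · obtain ⟨ψ, hψ, hφψ⟩ := Palyutin.exists_palyutin_of_bipreserved.{u, v, w, w} hφ h
    exact ⟨ψ, hψ, Palyutin.iff_empty_iff.2 hφψ⟩
  · rw [Palyutin.iff_empty_iff] at h
    rw [Palyutin.bipreservedUnderReducedProducts_iff]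
    intro I F _ M _ _ v
    simp only [h]
    exact hψ.realize_formula_reducedProduct v
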